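/- Let $\Omega$ be a domain in $\mathbb C$. Let $X$ be a compact (Hausdorff, reduced) complex space, and let $E$ be a hermitian metric on $X$ or, more generally, a length function on $X$, i.e. a continuous function $E\colon TX\to[0,\infty)$ on the tangent bundle of $X$ such that $E(v)=0$ if and only if $v=0$, and $E(av)=|a|\,E(v)$ for all $a\in\mathbb C$, $v\in TX$. Let $S$ be a complex hypersurface in $X$ (an analytic subset of codimension one at each of its points), let $M=X\setminus S$, and let $\mathcal F\subset \mathrm{Hol}(\Omega,M)$ be a family of holomorphic maps. The family $\mathcal F$ is called normal if it is relatively compact in $\mathrm{Hol}(\Omega,M)$ with respect to the compact-open topology. Then $\mathcal F$ is not normal if and only if there exist sequences $\{p_j\}\subset\Omega$ with $p_j\to p_0\in\Omega$, $\{f_j\}\subset\mathcal F$ and $\{\rho_j\}\subset\mathbb R$ with $\rho_j>0$ and $\rho_j\to0$ such that the sequence $$g_j(\xi):=f_j(p_j+\rho_j\xi)$$ (defined for those $\xi\in\mathbb C$ with $p_j+\rho_j\xi\in\Omega$, hence on any given compact subset of $\mathbb C$ for all large $j$) satisfies one of the following two assertions: (i) $\{g_j\}$ is compactly divergent on $\mathbb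 C$: for every compact $K\subset\mathbb C$ and every compact $L\subset M$ there is $j_0$ such that $g_j(K)\cap L=\emptyset$ for all $j\ge j_0$; (ii) $\{g_j\}$ converges uniformly on compact subsets of $\mathbb C$ to a non-constant $E$-Brody curve $g\colon\mathbb C\to M$, i.e. to a non-constant holomorphic map $g\colon\mathbb C\to M$ for which $E(g'(z))$ is bounded on $\mathbb C$. Completeness of $E$ on $M$ is not assumed. -/

import Mathlib

open Set Filter Topology

/-- `A` is an analytic subset of the open set `D ⊆ ℂⁿ`: near every point of `D` it is the set of
common zeros of finitely many holomorphic functions. -/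
def IsAnalyticIn {n : ℕ} (D A : Set (Fin n → ℂ)) : Prop :=
  A ⊆ D ∧ ∀ z ∈ D, ∃ (k : ℕ) (f : (Fin n → ℂ) → (Fin k → ℂ)),
    AnalyticAt ℂ f z ∧ ∀ᶠ w in 𝓝 z, (w ∈ A ↔ f w = 0)

/-- A local model chart of a topological space `X`: a homeomorphism of an open subset `source` of
`X` onto an analytic subset of an open set `domain` of some `ℂⁿ`. The values of `toFun` outside
`source` are irrelevant. -/
structure AnalyticChart (X : Type*) [TopologicalSpace X] where
  /-- dimension of the ambient space -/
  dim : ℕ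
  /-- the open subset of `X` on which the chart is defined -/
  source : Set X
  /-- the embedding into `ℂⁿ` -/
  toFun : X → (Fin dim → ℂ)
  /-- the open set of `ℂⁿ` in which the image is analytic -/
  domain : Set (Fin dim → ℂ)
  isOpen_source : IsOpen source
  isOpen_domain : IsOpen domain
  isEmbedding : IsEmbedding (source.domRestrict toFun)
  isAnalyticIn_image : IsAnalyticIn domain (toFun '' source)

/-- The (Zariski) tangent space at `x`, seen in a chart: the vectors that are killed by the
differentials of all holomorphic functions vanishing on the local model near the point. -/
def AnalyticChart.tangentSpace {X : Type*} [TopologicalSpace X] (c : AnalyticChart X) (x : X) :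
    Submodule ℂ (Fin c.dim → ℂ) where
  carrier := {v | ∀ h : (Fin c.dim → ℂ) → ℂ, AnalyticAt ℂ h (c.toFun x) →
    (∀ᶠ w in 𝓝 (c.toFun x), w ∈ c.toFun '' c.source → h w = 0) →
      fderiv ℂ h (c.toFun x) v = 0}
  add_mem' := by
    intro v w hv hw h h1 h2
    rw [map_add, hv h h1 h2, hw h h1 h2, add_zero]
  zero_mem' := by
    intro h _ _
    exact map_zero _
  smul_mem' := by
    intro a v hv h h1 h2
    rw [map_smul, hv h h1 h2, smul_zero]

/-- A (reduced) complex space structure on a topological space `X`: a covering of `X` by local model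
charts such that the transition maps are locally restrictions of holomorphic maps between the
ambient spaces. The Hausdorff property is a separate hypothesis `[T2Space X]`. -/
class ComplexSpace (X : Type*) [TopologicalSpace X] where
  /-- the charts of the complex space -/
  atlas : Set (AnalyticChart X)
  exists_chart : ∀ x : X, ∃ c ∈ atlas, x ∈ c.source
  compatible : ∀ c ∈ atlas, ∀ d ∈ atlas, ∀ x ∈ c.source ∩ d.source,
    ∃ F : (Fin c.dim → ℂ) → (Fin d.dim → ℂ), AnalyticAt ℂ F (c.toFun x) ∧
      ∀ᶠ y in 𝓝 x, d.toFun y = F (c.toFun y)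

namespace ComplexSpace

section TangentBundle

variable (X : Type*) [TopologicalSpace X] [ComplexSpace X]

/-- The disjoint union over all charts `c` of the tangent bundles of the local models,
`{(x, v) : x ∈ U_c, v ∈ T_x} ⊆ U_c × ℂⁿ`, with its natural topology. -/
abbrev ChartVector : Type _ :=
  Σ c : (atlas : Set (AnalyticChart X)),
    {p : X × (Fin c.1.dim → ℂ) // p.1 ∈ c.1.source ∧ p.2 ∈ c.1.tangentSpace p.1}

variable {X}

/-- Two vectors in charts represent the same tangent vector of `X`: they have the same base point
and the differential of the coordinate change carries one to the other. -/
def SameVector (a b : ChartVector X) : Prop :=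
  a.2.1.1 = b.2.1.1 ∧ ∃ F : (Fin a.1.1.dim → ℂ) → (Fin b.1.1.dim → ℂ),
    AnalyticAt ℂ F (a.1.1.toFun a.2.1.1) ∧
    (∀ᶠ y in 𝓝 a.2.1.1, b.1.1.toFun y = F (a.1.1.toFun y)) ∧
    b.2.1.2 = fderiv ℂ F (a.1.1.toFun a.2.1.1) a.2.1.2

variable (X)

/-- The tangent bundle `TX` of a complex space, glued from the tangent bundles of the local models
(with the quotient topology). -/
def TBundle : Type _ := Quot (SameVector (X := X))

instance : TopologicalSpace (TBundle X) :=
  inferInstanceAs (TopologicalSpace (Quot (SameVector (X := X))))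

variable {X}

/-- The tangent vector at `x` that is given by `v` in the chart `c`. -/
def tangentVector (c : AnalyticChart X) (hc : c ∈ atlas) (x : X) (hx : x ∈ c.source)
    (v : Fin c.dim → ℂ) (hv : v ∈ c.tangentSpace x) : TBundle X :=
  Quot.mk _ ⟨⟨c, hc⟩, ⟨(x, v), hx, hv⟩⟩

variable (X)

/-- A length function on a complex space: a continuous function `E ≥ 0` on the tangent bundle `TX`
with `E v = 0` iff `v = 0`, and `E (a v) = |a| E v` for `a ∈ ℂ`. The norm `v ↦ √(h(v, v))` of a
hermitian metric `h` on `X` is a length function. -/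
structure LengthFunction where
  /-- the function on the tangent bundle -/
  toFun : TBundle X → ℝ
  continuous_toFun : Continuous toFun
  nonneg : ∀ τ, 0 ≤ toFun τ
  eq_zero_iff : ∀ (c : AnalyticChart X) (hc : c ∈ atlas) (x : X) (hx : x ∈ c.source)
    (v : Fin c.dim → ℂ) (hv : v ∈ c.tangentSpace x),
    toFun (tangentVector c hc x hx v hv) = 0 ↔ v = 0
  map_smul : ∀ (c : AnalyticChart X) (hc : c ∈ atlas) (x : X) (hx : x ∈ c.source)
    (a : ℂ) (v : Fin c.dim → ℂ) (hv : v ∈ c.tangentSpace x),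
    toFun (tangentVector c hc x hx (a • v) (Submodule.smul_mem _ a hv)) =
      ‖a‖ * toFun (tangentVector c hc x hx v hv)

end TangentBundle

section Curves

variable {X : Type*} [TopologicalSpace X] [ComplexSpace X]

/-- A map from (a neighbourhood of `z` in) `ℂ` to the complex space `X` is holomorphic near `z`:
it is continuous at `z` and holomorphic near `z` when read in charts. -/
def HolomorphicAt (f : ℂ → X) (z : ℂ) : Prop :=
  ContinuousAt f z ∧ ∀ c ∈ (atlas : Set (AnalyticChart X)), f z ∈ c.source →
    AnalyticAt ℂ (fun w => c.toFun (f w)) z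

/-- The derivative of a holomorphic curve, read in a chart, is a tangent vector. -/
theorem HolomorphicAt.deriv_mem {f : ℂ → X} {z : ℂ} (hf : HolomorphicAt f z)
    {c : AnalyticChart X} (hc : c ∈ atlas) (hx : f z ∈ c.source) :
    deriv (fun w => c.toFun (f w)) z ∈ c.tangentSpace (f z) := by
  intro h h1 h2
  have ha := hf.2 c hc hx
  have hd := (h1.differentiableAt.hasFDerivAt.comp_hasDerivAt z
    ha.differentiableAt.hasDerivAt)
  have hs : ∀ᶠ w in 𝓝 z, f w ∈ c.source := hf.1 (c.isOpen_source.mem_nhds hx)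
  have he : (h ∘ fun w => c.toFun (f w)) =ᶠ[𝓝 z] fun _ => (0 : ℂ) := by
    filter_upwards [hs, ha.continuousAt.eventually h2] with w hw hw2
    exact hw2 ⟨f w, hw, rfl⟩
  have h0 := he.deriv_eq
  rw [hd.deriv, deriv_const] at h0
  exact h0

/-- The derivative `f'(z) ∈ TX` of a holomorphic curve. -/
noncomputable def velocity (f : ℂ → X) (z : ℂ) (hf : HolomorphicAt f z) : TBundle X :=
  tangentVector (exists_chart (f z)).choose (exists_chart (f z)).choose_spec.1 (f z)
    (exists_chart (f z)).choose_spec.2 _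
    (hf.deriv_mem (exists_chart (f z)).choose_spec.1 (exists_chart (f z)).choose_spec.2)

/-- `g : ℂ → X` is an `E`-Brody curve: it is holomorphic and `|g'|_E` is bounded on `ℂ`. -/
def IsBrodyCurve (E : LengthFunction X) (g : ℂ → X) : Prop :=
  ∃ hg : ∀ z, HolomorphicAt g z, ∃ C : ℝ, ∀ z, E.toFun (velocity g z (hg z)) ≤ C

/-- `Hol(Ω, M)` for an open set `Ω ⊆ ℂ` and an open subset `M` of `X`: the continuous maps
`Ω → M` that are holomorphic as maps to `X`. As a subtype of `C(Ω, M)` it carries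
the compact-open topology. -/
def Hol (Ω : Set ℂ) (M : Set X) : Set C(Ω, M) :=
  {f | ∃ F : ℂ → X, (∀ z : Ω, F z = f z) ∧ ∀ z ∈ Ω, HolomorphicAt F z}

/-- A family of holomorphic maps is normal if it is relatively compact in `Hol(Ω, M)`. -/
def IsNormalFamily {Ω : Set ℂ} {M : Set X} (F : Set (Hol Ω M)) : Prop :=
  IsCompact (closure F)

end Curves

section Hypersurface

variable {X : Type*} [TopologicalSpace X] [ComplexSpace X]

/-- A complex-valued function on `X` is holomorphic near `x`: in charts it is locally the
restriction of a holomorphic function on the ambient space. -/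
def HolomorphicFunctionAt (h : X → ℂ) (x : X) : Prop :=
  ∀ c ∈ (atlas : Set (AnalyticChart X)), x ∈ c.source →
    ∃ H : (Fin c.dim → ℂ) → ℂ, AnalyticAt ℂ H (c.toFun x) ∧ ∀ᶠ y in 𝓝 x, h y = H (c.toFun y)

/-- `S` is an analytic subset of the complex space `X`. -/
def IsAnalyticSubset (S : Set X) : Prop :=
  ∀ x : X, ∃ (k : ℕ) (h : Fin k → X → ℂ), (∀ i, HolomorphicFunctionAt (h i) x) ∧
    ∀ᶠ y in 𝓝 x, (y ∈ S ↔ ∀ i, h i y = 0)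

/-- The dimension at `x ∈ S` of an analytic subset `S` of `X`: the least number of holomorphic
functions near `x` vanishing at `x` for which `x` is an isolated point of their common zero set
in `S`. -/
noncomputable def localDim (S : Set X) (x : X) : ℕ :=
  sInf {k | ∃ h : Fin k → X → ℂ, (∀ i, HolomorphicFunctionAt (h i) x ∧ h i x = 0) ∧
    ∀ᶠ y in 𝓝 x, y ∈ S → (∀ i, h i y = 0) → y = x}

/-- A complex hypersurface: an analytic subset of codimension one at each of its points. -/
def IsHypersurface (S : Set X) : Prop :=
  IsAnalyticSubset S ∧ ∀ x ∈ S, localDim S x + 1 = localDim (univ : Set X) x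

end Hypersurface

section Sequences

variable {X : Type*} [TopologicalSpace X]

/-- The rescaled map `ξ ↦ f (p + ρ ξ)`, defined for those `ξ ∈ ℂ` for which `p + ρ ξ ∈ Ω`. -/
noncomputable def rescale {Ω : Set ℂ} {M : Set X} (f : C(Ω, M)) (p : ℂ) (ρ : ℝ)
    (ξ : {ξ : ℂ | p + ρ * ξ ∈ Ω}) : M :=
  f ⟨p + ρ * ξ, ξ.2⟩

/-- A sequence of maps `g j : D j → M` on subsets of `ℂ` is compactly divergent on `ℂ`: for all
compact `K ⊆ ℂ`, `L ⊆ M` and all large `j`, the map `g j` is defined on `K` and `g j (K)` does not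
meet `L`. -/
def CompactlyDivergent {M : Set X} {D : ℕ → Set ℂ} (g : ∀ j, D j → M) : Prop :=
  ∀ K : Set ℂ, IsCompact K → ∀ L : Set M, IsCompact L →
    ∃ j₀, ∀ j ≥ j₀, ∀ ξ ∈ K, ∃ h : ξ ∈ D j, g j ⟨ξ, h⟩ ∉ L

/-- A sequence of maps `g j : D j → M` on subsets of `ℂ` converges to `G : ℂ → M` uniformly on
compact subsets of `ℂ` (on each compact set the `g j` are defined for large `j`). Uniformity refers
to the unique uniform structure of the compact Hausdorff space `X ⊇ M`. -/
def ConvergesUniformlyOnCompacts [CompactSpace X] [T2Space X] {M : Set X} {D : ℕ → Set ℂ}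
    (g : ∀ j, D j → M) (G : ℂ → M) : Prop :=
  ∀ K : Set ℂ, IsCompact K → ∀ V ∈ (uniformSpaceOfCompactR1 (γ := X)).uniformity,
    ∃ j₀, ∀ j ≥ j₀, ∀ ξ ∈ K, ∃ h : ξ ∈ D j, ((G ξ : X), (g j ⟨ξ, h⟩ : X)) ∈ V

end Sequences

end ComplexSpace

/-!
A family `F` of holomorphic maps into `M = X \ S` can fail to be relatively compact in `Hol(Ω, M)`
for two reasons, and each of them produces a rescaled sequence.

If the speeds `E (f')`, `f ∈ F`, are locally bounded on `Ω`, then `F` is equicontinuous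
(`LengthFunction.exists_equicontinuity`), every ultrafilter on `F` converges locally uniformly to a
holomorphic map `g : Ω → X` (`LengthFunction.exists_tendsto_prod`,
`LengthFunction.holomorphicAt_of_tendsto_prod`), and a failure of normality means that some such `g`
takes a value in `S` at a point `p₀`. Rescaling around `p₀` squeezes the images of large discs to
`g p₀ ∈ S`, which is compact divergence in `M` (`exists_compactlyDivergent`).

If the speeds are unbounded near a point, the method of Brody and Zalcman
(`exists_rescaled_limit`) gives rescaled maps whose speed is `1` at the origin and at most `2` on
large discs, and these converge to a non-constant Brody curve `g : ℂ → X`. If `g` avoids `S`, this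
is the second alternative. If `g ξ₀ ∈ S`, one more rescaling around `ξ₀` squeezes the images to a
point of `S`, as before. Thus no theorem of Hurwitz type is needed, which can in fact fail for
hypersurfaces that are not locally given by one equation; of `S` only its closedness matters.

Conversely, along an ultrafilter the members of a normal family converge uniformly near `p₀` to a
map into `M`, so the rescaled maps converge to a constant in `M`, against both alternatives
(`IsNormalFamily.not_exists_sequences`).

The euclidean length in a chart is controlled by `E` over compact sets because the tangent bundle
of the local model is closed (`AnalyticChart.mem_tangentSpace_of_mem_closure`); this needs only that
a function vanishing on the model near a point also vanishes on it near the neighbouring points.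
Locally uniform convergence of `G i` to `g` along a filter `l` is expressed throughout as
`G i w → g z` along `l ×ˢ 𝓝 z` for every `z`, which makes sense without a uniform structure on `X`
and without continuity of the `G i` away from the point considered.
-/

/-! ### The tangent bundle in charts -/

namespace AnalyticChart

variable {X : Type*} [TopologicalSpace X] (c : AnalyticChart X)

theorem continuousAt_toFun {x : X} (hx : x ∈ c.source) : ContinuousAt c.toFun x :=
  (continuousOn_iff_continuous_domRestrict.2 c.isEmbedding.continuous).continuousAt
    (c.isOpen_source.mem_nhds hx)

/-- The neighbourhoods of a point of the chart domain are seen by the chart. -/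
theorem exists_ball_subset {x : X} (hx : x ∈ c.source) {U : Set X} (hU : U ∈ 𝓝 x) :
    ∃ ε > 0, ∀ y ∈ c.source, ‖c.toFun y - c.toFun x‖ < ε → y ∈ U := by
  have h := c.isEmbedding.isInducing.nhds_eq_comap ⟨x, hx⟩
  have h2 : (Subtype.val ⁻¹' U : Set c.source) ∈ 𝓝 (⟨x, hx⟩ : c.source) :=
    continuous_subtype_val.continuousAt.preimage_mem_nhds hU
  rw [h, mem_comap] at h2
  obtain ⟨t, ht, hs⟩ := h2
  obtain ⟨ε, hε, hb⟩ := Metric.mem_nhds_iff.1 ht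
  refine ⟨ε, hε, fun y hy hyx => ?_⟩
  exact hs (a := ⟨y, hy⟩) (hb (by rw [Metric.mem_ball, dist_eq_norm]; exact hyx))

/-- The part of the tangent bundle of the local model that lies over the chart domain. -/
def tangentSet : Set (X × (Fin c.dim → ℂ)) :=
  {p | p.1 ∈ c.source ∧ p.2 ∈ c.tangentSpace p.1}

/-- The tangent spaces vary upper semicontinuously: a holomorphic function that vanishes on the
local model near a point does so near all neighbouring points, so its differential kills the nearby
tangent vectors and, in the limit, those over the closure. -/
theorem mem_tangentSpace_of_mem_closure {p : X × (Fin c.dim → ℂ)} (hp : p.1 ∈ c.source)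
    (hcl : p ∈ closure c.tangentSet) : p.2 ∈ c.tangentSpace p.1 := by
  intro h h1 h2
  have hc := c.continuousAt_toFun hp
  have hd : ContinuousAt (fun q : X × (Fin c.dim → ℂ) => fderiv ℂ h (c.toFun q.1) q.2) p := by
    have h3 : ContinuousAt (fun q : X × (Fin c.dim → ℂ) => c.toFun q.1) p :=
      ContinuousAt.comp (f := Prod.fst) hc continuousAt_fst
    have h4 : ContinuousAt (fderiv ℂ h) (c.toFun p.1) := h1.fderiv.continuousAt
    exact (ContinuousAt.comp (f := fun q : X × (Fin c.dim → ℂ) => c.toFun q.1) h4 h3).clm_apply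
      continuousAt_snd
  have hev : ∀ᶠ q in 𝓝 p, q ∈ c.tangentSet → fderiv ℂ h (c.toFun q.1) q.2 = 0 := by
    have h5 : Tendsto (fun q : X × (Fin c.dim → ℂ) => c.toFun q.1) (𝓝 p) (𝓝 (c.toFun p.1)) :=
      ContinuousAt.comp (f := Prod.fst) hc continuousAt_fst
    filter_upwards [h5.eventually h1.eventually_analyticAt, h5.eventually h2.eventually_nhds]
      with q hq1 hq2 hq3
    exact hq3.2 h hq1 hq2
  have hfr : ∃ᶠ q in 𝓝 p, fderiv ℂ h (c.toFun q.1) q.2 ∈ ({0} : Set ℂ) :=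
    ((mem_closure_iff_frequently.1 hcl).and_eventually hev).mono fun q hq => hq.2 hq.1
  exact isClosed_singleton.mem_of_frequently_of_tendsto hfr hd

theorem isCompact_unit_tangentSet [T2Space X] {K : Set X} (hK : IsCompact K)
    (hKs : K ⊆ c.source) :
    IsCompact {p | p ∈ c.tangentSet ∧ p.1 ∈ K ∧ ‖p.2‖ = 1} := by
  refine (hK.prod (isCompact_sphere (0 : Fin c.dim → ℂ) 1)).of_isClosed_subset ?_
    fun p hp => ⟨hp.2.1, by simpa using hp.2.2⟩
  have hcl : IsClosed (K ×ˢ Metric.sphere (0 : Fin c.dim → ℂ) 1) :=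
    hK.isClosed.prod Metric.isClosed_sphere
  refine isClosed_of_closure_subset fun p hp => ?_
  have h1 : p ∈ K ×ˢ Metric.sphere (0 : Fin c.dim → ℂ) 1 := by
    refine closure_minimal ?_ hcl hp
    exact fun q hq => ⟨hq.2.1, by simpa using hq.2.2⟩
  have h2 : p ∈ closure c.tangentSet := closure_mono (fun q hq => hq.1) hp
  exact ⟨⟨hKs h1.1, c.mem_tangentSpace_of_mem_closure (hKs h1.1) h2⟩, h1.1, by simpa using h1.2⟩

end AnalyticChart

/-! ### Speed of holomorphic curves -/

namespace ComplexSpace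

variable {X : Type*} [TopologicalSpace X] [ComplexSpace X]

theorem velocity_eq {f : ℂ → X} {z : ℂ} (hf : HolomorphicAt f z) {c : AnalyticChart X}
    (hc : c ∈ atlas) (hx : f z ∈ c.source) :
    velocity f z hf = tangentVector c hc (f z) hx _ (hf.deriv_mem hc hx) := by
  obtain ⟨hd, hdx⟩ := (exists_chart (f z)).choose_spec
  obtain ⟨F, hF, hFe⟩ := compatible _ hd c hc (f z) ⟨hdx, hx⟩
  refine Quot.sound ⟨rfl, F, hF, hFe, ?_⟩
  have h1 := hF.differentiableAt.hasFDerivAt.comp_hasDerivAt z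
    (hf.2 _ hd hdx).differentiableAt.hasDerivAt
  have h2 : (fun w => c.toFun (f w)) =ᶠ[𝓝 z] F ∘ fun w => (exists_chart (f z)).choose.toFun (f w) :=
    hf.1.eventually hFe
  exact h2.deriv_eq.trans h1.deriv

open Classical in
/-- The length of the vector `v` at `x` read in the chart `c`, extended by `0` to all pairs `(x, v)`
that are not in the tangent bundle. -/
noncomputable def LengthFunction.inChart (E : LengthFunction X) (c : AnalyticChart X)
    (hc : c ∈ atlas) (p : X × (Fin c.dim → ℂ)) : ℝ :=
  if h : p ∈ c.tangentSet then E.toFun (tangentVector c hc p.1 h.1 p.2 h.2) else 0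

theorem LengthFunction.inChart_eq (E : LengthFunction X) {c : AnalyticChart X} (hc : c ∈ atlas)
    {x : X} (hx : x ∈ c.source) {v : Fin c.dim → ℂ} (hv : v ∈ c.tangentSpace x) :
    E.inChart c hc (x, v) = E.toFun (tangentVector c hc x hx v hv) :=
  dif_pos (show (x, v) ∈ c.tangentSet from ⟨hx, hv⟩)

theorem LengthFunction.continuousOn_inChart (E : LengthFunction X) {c : AnalyticChart X}
    (hc : c ∈ atlas) : ContinuousOn (E.inChart c hc) c.tangentSet := by
  rw [continuousOn_iff_continuous_domRestrict]
  have h : Continuous fun p : c.tangentSet =>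
      E.toFun (Quot.mk SameVector (⟨⟨c, hc⟩, p⟩ : ChartVector X)) :=
    E.continuous_toFun.comp (continuous_quot_mk.comp
      (continuous_sigmaMk (σ := fun c : (atlas : Set (AnalyticChart X)) =>
        {p : X × (Fin c.1.dim → ℂ) // p.1 ∈ c.1.source ∧ p.2 ∈ c.1.tangentSpace p.1})
        (i := ⟨c, hc⟩)))
  convert h using 1
  ext p
  exact dif_pos p.2

/-- Over a compact subset of a chart domain, the euclidean length is controlled by `E`. -/
theorem LengthFunction.exists_mul_norm_le [T2Space X] (E : LengthFunction X) {c : AnalyticChart X}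
    (hc : c ∈ atlas) {K : Set X} (hK : IsCompact K) (hKs : K ⊆ c.source) :
    ∃ m > 0, ∀ x ∈ K, ∀ v ∈ c.tangentSpace x, m * ‖v‖ ≤ E.inChart c hc (x, v) := by
  have hcomp := c.isCompact_unit_tangentSet hK hKs
  obtain ⟨m, hm, hle⟩ : ∃ m > 0, ∀ p ∈ {p | p ∈ c.tangentSet ∧ p.1 ∈ K ∧ ‖p.2‖ = 1},
      m ≤ E.inChart c hc p := by
    refine hcomp.exists_forall_le' (a := 0)
      ((E.continuousOn_inChart hc).mono fun p hp => hp.1) ?_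
    rintro ⟨x, v⟩ ⟨⟨hx, hv⟩, -, h1⟩
    rw [E.inChart_eq hc hx hv]
    refine lt_of_le_of_ne (E.nonneg _) fun h0 => ?_
    have := (E.eq_zero_iff c hc x hx v hv).1 h0.symm
    simp [this] at h1
  refine ⟨m, hm, fun x hx v hv => ?_⟩
  rcases eq_or_ne v 0 with rfl | h0
  · rw [E.inChart_eq hc (hKs hx) hv]
    simpa using E.nonneg _
  have hn : ‖v‖ ≠ 0 := norm_ne_zero_iff.2 h0
  have hv' : (((‖v‖ : ℝ) : ℂ)⁻¹) • v ∈ c.tangentSpace x := Submodule.smul_mem _ _ hv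
  have h1 := hle (x, (((‖v‖ : ℝ) : ℂ)⁻¹) • v)
    ⟨⟨hKs hx, hv'⟩, hx, by simp [norm_smul, hn]⟩
  rw [E.inChart_eq hc (hKs hx) hv', E.map_smul c hc x (hKs hx) _ v hv] at h1
  rw [E.inChart_eq hc (hKs hx) hv]
  rw [norm_inv, Complex.norm_real, norm_norm, inv_mul_eq_div, le_div_iff₀ (by positivity)] at h1
  exact h1

open Classical in
/-- The length `E (f' z)` of the derivative of `f` at `z`, and `0` if `f` is not holomorphic
near `z`. -/
noncomputable def LengthFunction.speed (E : LengthFunction X) (f : ℂ → X) (z : ℂ) : ℝ :=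
  if h : HolomorphicAt f z then E.toFun (velocity f z h) else 0

theorem LengthFunction.speed_eq_velocity (E : LengthFunction X) {f : ℂ → X} {z : ℂ}
    (hf : HolomorphicAt f z) : E.speed f z = E.toFun (velocity f z hf) :=
  dif_pos hf

theorem LengthFunction.speed_nonneg (E : LengthFunction X) (f : ℂ → X) (z : ℂ) :
    0 ≤ E.speed f z := by
  unfold LengthFunction.speed
  split_ifs
  exacts [E.nonneg _, le_rfl]

theorem LengthFunction.speed_eq_inChart (E : LengthFunction X) {f : ℂ → X} {z : ℂ}
    (hf : HolomorphicAt f z) {c : AnalyticChart X} (hc : c ∈ atlas) (hx : f z ∈ c.source) :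
    E.speed f z = E.inChart c hc (f z, deriv (fun w => c.toFun (f w)) z) := by
  rw [E.speed_eq_velocity hf, velocity_eq hf hc hx, E.inChart_eq hc hx (hf.deriv_mem hc hx)]

theorem LengthFunction.speed_const (E : LengthFunction X) {f : ℂ → X} {z : ℂ}
    (hf : HolomorphicAt f z) (h : ∀ w, f w = f z) : E.speed f z = 0 := by
  obtain ⟨c, hc, hx⟩ := exists_chart (f z)
  rw [E.speed_eq_inChart hf hc hx, E.inChart_eq hc hx (hf.deriv_mem hc hx), E.eq_zero_iff]
  have : (fun w => c.toFun (f w)) = fun _ => c.toFun (f z) := funext fun w => by rw [h]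
  rw [this, deriv_const]

theorem HolomorphicAt.comp_affine {f : ℂ → X} {p : ℂ} {ρ : ℝ} {ξ : ℂ}
    (hf : HolomorphicAt f (p + ρ * ξ)) : HolomorphicAt (fun ξ : ℂ => f (p + ρ * ξ)) ξ := by
  refine ⟨ContinuousAt.comp (f := fun ξ : ℂ => p + ρ * ξ) hf.1 (by fun_prop), fun c hc hx => ?_⟩
  exact (hf.2 c hc hx).comp_of_eq (f := fun ξ : ℂ => p + ρ * ξ)
    (by fun_prop) rfl

theorem LengthFunction.speed_comp_affine (E : LengthFunction X) {f : ℂ → X} {p : ℂ} {ρ : ℝ}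
    (hρ : 0 ≤ ρ) {ξ : ℂ} (hf : HolomorphicAt f (p + ρ * ξ)) :
    E.speed (fun ξ : ℂ => f (p + ρ * ξ)) ξ = ρ * E.speed f (p + ρ * ξ) := by
  obtain ⟨c, hc, hx⟩ := exists_chart (f (p + ρ * ξ))
  have h1 : deriv (fun ξ : ℂ => c.toFun (f (p + ρ * ξ))) ξ =
      (ρ : ℂ) • deriv (fun w => c.toFun (f w)) (p + ρ * ξ) := by
    have ha : HasDerivAt (fun ξ : ℂ => p + ρ * ξ) (ρ : ℂ) ξ := by
      simpa using ((hasDerivAt_id ξ).const_mul (ρ : ℂ)).const_add p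
    exact ((hf.2 c hc hx).differentiableAt.hasDerivAt.scomp ξ ha).deriv
  rw [E.speed_eq_inChart hf.comp_affine hc hx, E.speed_eq_inChart hf hc hx, h1,
    E.inChart_eq hc hx (Submodule.smul_mem _ _ (hf.deriv_mem hc hx)),
    E.inChart_eq hc hx (hf.deriv_mem hc hx), E.map_smul c hc _ hx _ _ (hf.deriv_mem hc hx)]
  simp [abs_of_nonneg hρ]

theorem LengthFunction.continuousOn_speed (E : LengthFunction X) {f : ℂ → X} {U : Set ℂ}
    (hf : ∀ z ∈ U, HolomorphicAt f z) : ContinuousOn (E.speed f) U := by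
  intro z hz
  obtain ⟨c, hc, hx⟩ := exists_chart (f z)
  have hfz := hf z hz
  have h1 : ContinuousAt (fun w => (f w, deriv (fun w => c.toFun (f w)) w)) z :=
    hfz.1.prodMk (hfz.2 c hc hx).deriv.continuousAt
  have hs : ∀ᶠ w in 𝓝[U] z, w ∈ U ∧ f w ∈ c.source :=
    (eventually_mem_nhdsWithin).and
      (nhdsWithin_le_nhds (hfz.1.eventually (c.isOpen_source.mem_nhds hx)))
  have h2 : Tendsto (fun w => (f w, deriv (fun w => c.toFun (f w)) w)) (𝓝[U] z)
      (𝓝[c.tangentSet] (f z, deriv (fun w => c.toFun (f w)) z)) :=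
    tendsto_nhdsWithin_iff.2 ⟨h1.mono_left nhdsWithin_le_nhds,
      hs.mono fun w hw => ⟨hw.2, (hf w hw.1).deriv_mem hc hw.2⟩⟩
  have h3 := (E.continuousOn_inChart hc _
    (show (f z, deriv (fun w => c.toFun (f w)) z) ∈ c.tangentSet from
      ⟨hx, hfz.deriv_mem hc hx⟩)).tendsto.comp h2
  rw [ContinuousWithinAt, E.speed_eq_inChart hfz hc hx]
  refine h3.congr' (hs.mono fun w hw => ?_)
  exact (E.speed_eq_inChart (hf w hw.1) hc hw.2).symm

/-- Curves of bounded speed are equicontinuous, uniformly near a point of `X`: a curve that starts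
near `x` cannot leave a given neighbourhood of `x` along a short segment. -/
theorem LengthFunction.exists_equicontinuity [LocallyCompactSpace X] [T2Space X]
    (E : LengthFunction X) (x : X) {U : Set X} (hU : U ∈ 𝓝 x) (C : ℝ) :
    ∃ V ∈ 𝓝 x, ∃ δ > 0, ∀ (f : ℂ → X) (z w : ℂ), dist w z < δ →
      (∀ u ∈ segment ℝ z w, HolomorphicAt f u ∧ E.speed f u ≤ C) → f z ∈ V → f w ∈ U := by
  obtain ⟨c, hc, hx⟩ := exists_chart x
  obtain ⟨K, hKx, hKU, hK⟩ := local_compact_nhds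
    (inter_mem hU (c.isOpen_source.mem_nhds hx))
  have hKs : K ⊆ c.source := fun y hy => (hKU hy).2
  obtain ⟨m, hm, hmle⟩ := E.exists_mul_norm_le hc hK hKs
  obtain ⟨ε, hε, hball⟩ := c.exists_ball_subset hx (interior_mem_nhds.2 hKx)
  have hV : {y | ‖c.toFun y - c.toFun x‖ < ε / 2} ∈ 𝓝 x := by
    have : ContinuousAt (fun y => ‖c.toFun y - c.toFun x‖) x :=
      ((c.continuousAt_toFun hx).sub continuousAt_const).norm
    exact this.eventually_lt continuousAt_const (by simpa using hε)
  set C' := |C| + 1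
  have hC' : 0 < C' := by positivity
  refine ⟨_, inter_mem hV (interior_mem_nhds.2 hKx), ε / 2 * m / C', by positivity, ?_⟩
  intro f z w hd hf hz
  set γ : ℝ → ℂ := fun t => z + t * (w - z)
  have hγ : Continuous γ := by fun_prop
  have hγs : ∀ t ∈ Icc (0 : ℝ) 1, γ t ∈ segment ℝ z w := fun t ht => by
    rw [segment_eq_image']
    exact ⟨t, ht, by simp [γ]⟩
  have hcont : ∀ t ∈ Icc (0 : ℝ) 1, ContinuousAt (fun t => f (γ t)) t := fun t ht =>
    ContinuousAt.comp (f := γ) (hf _ (hγs t ht)).1.1 hγ.continuousAt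
  have hγ0 : γ 0 = z := by simp [γ]
  have hγ1 : γ 1 = w := by simp [γ]
  suffices H : ∀ t ∈ Icc (0 : ℝ) 1, f (γ t) ∈ interior K by
    rw [← hγ1]
    exact (hKU (interior_subset (H 1 (by simp)))).1
  by_contra! hcon
  -- the first time at which the curve is outside the interior of `K`
  set A : Set ℝ := Icc 0 1 ∩ {t | f (γ t) ∉ interior K}
  have hAc : IsClosed A := by
    have : ContinuousOn (fun t => f (γ t)) (Icc (0 : ℝ) 1) :=
      fun t ht => (hcont t ht).continuousWithinAt
    exact this.preimage_isClosed_of_isClosed isClosed_Icc isOpen_interior.isClosed_compl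
  have hAn : A.Nonempty := let ⟨t, ht, ht'⟩ := hcon; ⟨t, ht, ht'⟩
  have hAb : BddBelow A := ⟨0, fun t ht => ht.1.1⟩
  obtain ⟨⟨h0, h1⟩, hout⟩ := hAc.csInf_mem hAn hAb
  set s := sInf A
  have hin : ∀ t ∈ Ico 0 s, f (γ t) ∈ interior K := fun t ht => by
    by_contra h
    exact absurd (csInf_le hAb (show t ∈ A from ⟨⟨ht.1, ht.2.le.trans h1⟩, h⟩)) (not_le.2 ht.2)
  have hs0 : 0 < s := by
    refine lt_of_le_of_ne h0 fun h => hout ?_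
    rw [← h, hγ0]
    exact hz.2
  have hsK : f (γ s) ∈ K := by
    have hT : Tendsto (fun t => f (γ t)) (𝓝[<] s) (𝓝 (f (γ s))) :=
      (hcont s ⟨h0, h1⟩).tendsto.mono_left nhdsWithin_le_nhds
    refine hK.isClosed.mem_of_tendsto hT ?_
    filter_upwards [Ico_mem_nhdsLT hs0] with t ht
    exact interior_subset (hin t ht)
  have hinK : ∀ t ∈ Icc 0 s, f (γ t) ∈ K := fun t ht => by
    rcases eq_or_lt_of_le ht.2 with rfl | h
    exacts [hsK, interior_subset (hin t ⟨ht.1, h⟩)]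
  have hder : ∀ t ∈ Icc 0 s, HasDerivWithinAt (fun t => c.toFun (f (γ t)))
      ((w - z) • deriv (fun u => c.toFun (f u)) (γ t)) (Icc 0 s) t := fun t ht => by
    have ht1 : t ∈ Icc (0 : ℝ) 1 := ⟨ht.1, ht.2.trans h1⟩
    have hg : HasDerivAt γ (w - z) t := by
      have := (((hasDerivAt_id t).ofReal_comp).mul_const (w - z)).const_add z
      rwa [Complex.ofReal_one, one_mul] at this
    exact ((((hf _ (hγs t ht1)).1.2 c hc (hKs (hinK t ht))).differentiableAt.hasDerivAt).scomp
      t hg).hasDerivWithinAt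
  have hbd : ∀ t ∈ Ico 0 s, ‖(w - z) • deriv (fun u => c.toFun (f u)) (γ t)‖ ≤
      ‖w - z‖ * (C' / m) := fun t ht => by
    have ht1 : t ∈ Icc (0 : ℝ) 1 := ⟨ht.1, ht.2.le.trans h1⟩
    have htK := hinK t ⟨ht.1, ht.2.le⟩
    obtain ⟨hh, hsp⟩ := hf _ (hγs t ht1)
    have h2 := hmle _ htK _ (hh.deriv_mem hc (hKs htK))
    rw [← E.speed_eq_inChart hh hc (hKs htK)] at h2
    rw [norm_smul]
    gcongr
    rw [le_div_iff₀ hm]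
    have := le_abs_self C
    simp only [C']
    linarith
  have hmv := norm_image_sub_le_of_norm_deriv_le_segment' hder hbd s ⟨h0, le_rfl⟩
  have hwz : ‖w - z‖ * (C' / m) < ε / 2 := by
    rw [dist_eq_norm, lt_div_iff₀ hC'] at hd
    rw [← mul_div_assoc, div_lt_iff₀ hm]
    exact hd
  have hmv' : ‖c.toFun (f (γ s)) - c.toFun (f z)‖ < ε / 2 := by
    rw [hγ0] at hmv
    refine lt_of_le_of_lt (hmv.trans ?_) hwz
    rw [sub_zero]
    exact mul_le_of_le_one_right (by positivity) h1
  refine hout (hball _ (hKs hsK) ?_)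
  have hz1 : ‖c.toFun (f z) - c.toFun x‖ < ε / 2 := hz.1
  calc ‖c.toFun (f (γ s)) - c.toFun x‖
      ≤ ‖c.toFun (f (γ s)) - c.toFun (f z)‖ + ‖c.toFun (f z) - c.toFun x‖ :=
        norm_sub_le_norm_sub_add_norm_sub _ _ _
    _ < ε := by linarith

end ComplexSpace

/-! ### Limits of curves of bounded speed -/

namespace ComplexSpace

section Limits

variable {X : Type*} [TopologicalSpace X]

theorem tendsto_of_tendsto_prod {ι : Type*} {l : Filter ι} {G : ι → ℂ → X} {z : ℂ} {x : X}
    (h : Tendsto (fun p : ι × ℂ => G p.1 p.2) (l ×ˢ 𝓝 z) (𝓝 x)) :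
    Tendsto (fun i => G i z) l (𝓝 x) :=
  h.comp (tendsto_id.prodMk tendsto_const_nhds)

/-- If `G i w → g z` as `i → l` and `w → z`, for every `z` in an open set, then `g` is continuous
there; no continuity of the `G i` is needed. -/
theorem continuousAt_of_tendsto_prod [RegularSpace X] {ι : Type*} {l : Filter ι} [l.NeBot]
    {G : ι → ℂ → X} {g : ℂ → X} {U : Set ℂ} (hU : IsOpen U)
    (h : ∀ z ∈ U, Tendsto (fun p : ι × ℂ => G p.1 p.2) (l ×ˢ 𝓝 z) (𝓝 (g z))) {z : ℂ}
    (hz : z ∈ U) : ContinuousAt g z := by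
  refine (closed_nhds_basis (g z)).tendsto_right_iff.2 fun W hW => ?_
  have h1 := eventually_swap_iff.1 ((h z hz).eventually hW.1)
  filter_upwards [h1.curry, hU.mem_nhds hz] with w hw hwU
  exact hW.2.mem_of_tendsto (tendsto_of_tendsto_prod (h w hwU)) hw

theorem eventually_forall_of_eventually_prod {ι α : Type*} [TopologicalSpace α] {l : Filter ι}
    {K : Set α} (hK : IsCompact K) {P : ι → α → Prop}
    (h : ∀ z ∈ K, ∀ᶠ p in l ×ˢ 𝓝 z, P p.1 p.2) : ∀ᶠ i in l, ∀ z ∈ K, P i z := by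
  simp only [← eventually_iSup, ← hK.prod_nhdsSet_eq_biSup] at h
  exact h.curry.mono fun _ h ↦ h.self_of_nhdsSet

variable [ComplexSpace X]

/-- Montel's theorem for curves of locally bounded speed: an ultrafilter of such curves converges
locally uniformly, because it converges pointwise and the curves are equicontinuous. -/
theorem LengthFunction.exists_tendsto_prod [CompactSpace X] [T2Space X] (E : LengthFunction X)
    {ι : Type*} (l : Ultrafilter ι) {G : ι → ℂ → X} {U : Set ℂ}
    (hb : ∀ z ∈ U, ∃ C, ∀ᶠ p in (l : Filter ι) ×ˢ 𝓝 z,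
      HolomorphicAt (G p.1) p.2 ∧ E.speed (G p.1) p.2 ≤ C) :
    ∃ g : ℂ → X, ∀ z ∈ U,
      Tendsto (fun p : ι × ℂ => G p.1 p.2) ((l : Filter ι) ×ˢ 𝓝 z) (𝓝 (g z)) := by
  have hpt : ∀ z, ∃ x, Tendsto (fun i => G i z) l (𝓝 x) := fun z => by
    obtain ⟨x, -, hx⟩ := isCompact_univ.ultrafilter_le_nhds (l.map fun i => G i z) (by simp)
    exact ⟨x, hx⟩
  choose g hg using hpt
  refine ⟨g, fun z hz W hW => ?_⟩
  obtain ⟨C, hC⟩ := hb z hz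
  obtain ⟨pa, hpa, pb, hpb, hab⟩ := eventually_prod_iff.1 hC
  obtain ⟨r, hr, hrb⟩ := Metric.eventually_nhds_iff_ball.1 hpb
  obtain ⟨V, hV, δ, hδ, H⟩ := E.exists_equicontinuity (g z) hW C
  refine mem_map.2 ?_
  filter_upwards [prod_mem_prod (inter_mem hpa ((hg z).eventually hV))
    (Metric.ball_mem_nhds z (lt_min hr hδ))] with p hp
  obtain ⟨⟨h1, h2⟩, h3⟩ := hp
  refine H (G p.1) z p.2 (h3.trans_le (min_le_right _ _)) (fun u hu => ?_) h2
  exact hab h1 (hrb _ ((convex_ball z r).segment_subset (Metric.mem_ball_self hr)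
    (Metric.ball_subset_ball (min_le_left _ _) h3) hu))

/-- A locally uniform limit of holomorphic curves is holomorphic, and the speeds converge. -/
theorem LengthFunction.holomorphicAt_of_tendsto_prod [RegularSpace X] (E : LengthFunction X)
    {ι : Type*} {l : Filter ι} [l.NeBot] {G : ι → ℂ → X} {g : ℂ → X} {U : Set ℂ} (hU : IsOpen U)
    (hG : ∀ z ∈ U, ∀ᶠ p in l ×ˢ 𝓝 z, HolomorphicAt (G p.1) p.2)
    (h : ∀ z ∈ U, Tendsto (fun p : ι × ℂ => G p.1 p.2) (l ×ˢ 𝓝 z) (𝓝 (g z))) {z : ℂ}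
    (hz : z ∈ U) :
    HolomorphicAt g z ∧ Tendsto (fun i => E.speed (G i) z) l (𝓝 (E.speed g z)) := by
  have hgc : ContinuousAt g z := continuousAt_of_tendsto_prod hU h hz
  have key : ∀ c ∈ (atlas : Set (AnalyticChart X)), g z ∈ c.source →
      AnalyticAt ℂ (fun w => c.toFun (g w)) z ∧
        Tendsto (fun i => deriv (fun w => c.toFun (G i w)) z) l
          (𝓝 (deriv (fun w => c.toFun (g w)) z)) := by
    intro c hc hx
    have h1 := (hG z hz).and ((h z hz).eventually (c.isOpen_source.mem_nhds hx))
    obtain ⟨pa, hpa, pb, hpb, hab⟩ := eventually_prod_iff.1 h1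
    obtain ⟨N, hNs, hN, hzN⟩ := eventually_nhds_iff.1
      (hpb.and ((hU.eventually_mem hz).and (hgc.eventually (c.isOpen_source.mem_nhds hx))))
    have hdiff : ∀ᶠ i in l, DifferentiableOn ℂ (fun w => c.toFun (G i w)) N := by
      filter_upwards [hpa] with i hi w hw
      obtain ⟨h2, h3⟩ := hab hi (hNs w hw).1
      exact (h2.2 c hc h3).differentiableAt.differentiableWithinAt
    have hconv : TendstoLocallyUniformlyOn (fun i w => c.toFun (G i w))
        (fun w => c.toFun (g w)) l N := by
      rw [tendstoLocallyUniformlyOn_iff_forall_tendsto]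
      intro w hw
      obtain ⟨-, hwU, hws⟩ := hNs w hw
      have hcw := c.continuousAt_toFun hws
      have h2 : Tendsto (fun p : ι × ℂ => c.toFun (g p.2)) (l ×ˢ 𝓝 w) (𝓝 (c.toFun (g w))) :=
        hcw.tendsto.comp
          ((continuousAt_of_tendsto_prod hU h hwU).tendsto.comp tendsto_snd)
      have h3 : Tendsto (fun p : ι × ℂ => c.toFun (G p.1 p.2)) (l ×ˢ 𝓝 w)
          (𝓝 (c.toFun (g w))) := hcw.tendsto.comp (h w hwU)
      rw [hN.nhdsWithin_eq hw]
      exact (h2.prodMk_nhds h3).mono_right (nhds_le_uniformity _)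
    exact ⟨(hconv.differentiableOn hdiff hN).analyticAt (hN.mem_nhds hzN),
      (hconv.deriv hdiff hN).tendsto_at hzN⟩
  have hhol : HolomorphicAt g z := ⟨hgc, fun c hc hx => (key c hc hx).1⟩
  refine ⟨hhol, ?_⟩
  obtain ⟨c, hc, hx⟩ := exists_chart (g z)
  have h1 : ∀ᶠ i in l, HolomorphicAt (G i) z ∧ G i z ∈ c.source :=
    (tendsto_of_tendsto_prod (G := fun i w => (G i w)) (h z hz)).eventually
      (c.isOpen_source.mem_nhds hx) |>.and ((hG z hz).curry.mono fun i hi => hi.self_of_nhds)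
      |>.mono fun i hi => ⟨hi.2, hi.1⟩
  have h2 : Tendsto (fun i => (G i z, deriv (fun w => c.toFun (G i w)) z)) l
      (𝓝[c.tangentSet] (g z, deriv (fun w => c.toFun (g w)) z)) :=
    tendsto_nhdsWithin_iff.2 ⟨(tendsto_of_tendsto_prod (h z hz)).prodMk_nhds (key c hc hx).2,
      h1.mono fun i hi => ⟨hi.2, hi.1.deriv_mem hc hi.2⟩⟩
  have h3 := (E.continuousOn_inChart hc _
    (show (g z, deriv (fun w => c.toFun (g w)) z) ∈ c.tangentSet from
      ⟨hx, hhol.deriv_mem hc hx⟩)).tendsto.comp h2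
  rw [E.speed_eq_inChart hhol hc hx]
  exact h3.congr' (h1.mono fun i hi => (E.speed_eq_inChart hi.1 hc hi.2).symm)

end Limits

/-! ### Choice of centres and scales -/

/-- Zalcman's choice of centre and scale: `p` maximises `(r - |z - p₀|) φ z`, which makes `φ` on the
disc of radius `A ρ / 2` about `p` at most twice its value at `p`. -/
theorem exists_rescaling {φ : ℂ → ℝ} {p₀ z : ℂ} {r A : ℝ} (hA : 0 < A) (hφ : ∀ w, 0 ≤ φ w)
    (hc : ContinuousOn φ (Metric.closedBall p₀ r)) (hz : z ∈ Metric.closedBall p₀ r)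
    (hAz : A ≤ (r - dist z p₀) * φ z) :
    ∃ p ∈ Metric.closedBall p₀ r, ∃ ρ > 0, ρ ≤ r / A ∧ ρ * φ p = 1 ∧
      ∀ ξ : ℂ, ‖ξ‖ ≤ A / 2 →
        p + (ρ : ℝ) * ξ ∈ Metric.closedBall p₀ r ∧ ρ * φ (p + (ρ : ℝ) * ξ) ≤ 2 := by
  obtain ⟨p, hp, hmax⟩ := (isCompact_closedBall p₀ r).exists_isMaxOn ⟨z, hz⟩
    (f := fun w => (r - dist w p₀) * φ w) (by fun_prop)
  have hM : A ≤ (r - dist p p₀) * φ p := hAz.trans (hmax hz)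
  have hd0 : 0 ≤ r - dist p p₀ := sub_nonneg.2 hp
  have hφp : 0 < φ p := by
    rcases (hφ p).eq_or_lt with h | h
    · rw [← h, mul_zero] at hM
      linarith
    · exact h
  have hd : 0 < r - dist p p₀ := by
    rcases hd0.eq_or_lt with h | h
    · rw [← h, zero_mul] at hM
      linarith
    · exact h
  have hρd : (φ p)⁻¹ ≤ (r - dist p p₀) / A := by
    rw [inv_le_comm₀ hφp (by positivity), inv_div, div_le_iff₀ hd]
    linarith
  refine ⟨p, hp, (φ p)⁻¹, inv_pos.2 hφp, hρd.trans ?_, inv_mul_cancel₀ hφp.ne', ?_⟩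
  · gcongr
    linarith [dist_nonneg (x := p) (y := p₀)]
  intro ξ hξ
  set q := p + ((φ p)⁻¹ : ℝ) * ξ
  have hqp : dist q p ≤ (r - dist p p₀) / 2 := by
    have : dist q p = (φ p)⁻¹ * ‖ξ‖ := by
      simp only [q, dist_eq_norm, add_sub_cancel_left, norm_mul, Complex.norm_real,
        Real.norm_eq_abs, abs_of_pos (inv_pos.2 hφp)]
    rw [this]
    calc (φ p)⁻¹ * ‖ξ‖ ≤ (r - dist p p₀) / A * (A / 2) := by gcongr
      _ = (r - dist p p₀) / 2 := by field_simp
  have hq : dist q p₀ ≤ r - (r - dist p p₀) / 2 := by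
    linarith [dist_triangle q p p₀]
  have hqb : q ∈ Metric.closedBall p₀ r := by
    rw [Metric.mem_closedBall]
    linarith
  refine ⟨hqb, ?_⟩
  have h1 : (r - dist q p₀) * φ q ≤ (r - dist p p₀) * φ p := hmax hqb
  have h2 : (r - dist p p₀) / 2 * φ q ≤ (r - dist q p₀) * φ q :=
    mul_le_mul_of_nonneg_right (by linarith) (hφ q)
  rw [inv_mul_le_iff₀ hφp]
  have h3 : (r - dist p p₀) * φ q ≤ (r - dist p p₀) * (φ p * 2) := by linarith
  exact le_of_mul_le_mul_left h3 hd

/-! ### Metrizability -/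

/-- A compact complex space is metrizable, being covered by finitely many charts. -/
theorem metrizableSpace {X : Type*} [TopologicalSpace X] [ComplexSpace X] [CompactSpace X]
    [T2Space X] : TopologicalSpace.MetrizableSpace X := by
  choose c hc hx using fun x : X => exists_chart x
  obtain ⟨t, ht⟩ := isCompact_univ.elim_nhds_subcover (fun x => (c x).source)
    fun x _ => (c x).isOpen_source.mem_nhds (hx x)
  have : ∀ x : t, SecondCountableTopology (c x).source := fun x =>
    (c x).isEmbedding.secondCountableTopology
  have : SecondCountableTopology X :=
    TopologicalSpace.secondCountableTopology_of_countable_cover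
      (U := fun x : t => (c x).source) (fun x => (c x).isOpen_source) (by
        refine eq_univ_of_univ_subset (ht.2.trans fun y hy => ?_)
        simpa using hy)
  exact TopologicalSpace.metrizableSpace_of_t3_secondCountable X

end ComplexSpace

/-! ### Relative compactness by ultrafilters -/

/-- In a regular space, a set is relatively compact if every ultrafilter on it converges, possibly
to a point outside the set. -/
theorem isCompact_closure_of_ultrafilter {Y : Type*} [TopologicalSpace Y] [RegularSpace Y]
    {A : Set Y} (h : ∀ l : Ultrafilter Y, A ∈ l → ∃ y, (l : Filter Y) ≤ 𝓝 y) :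
    IsCompact (closure A) := by
  refine isCompact_iff_ultrafilter_le_nhds.2 fun l hl => ?_
  have hcl : closure A ∈ l := le_principal_iff.1 hl
  -- an ultrafilter on `A` that contains the open sets of `l`
  let m : Filter Y :=
    { sets := {T | ∃ W ∈ l, IsOpen W ∧ W ∩ A ⊆ T}
      univ_sets := ⟨univ, univ_mem, isOpen_univ, subset_univ _⟩
      sets_of_superset := fun ⟨W, h1, h2, h3⟩ h4 => ⟨W, h1, h2, h3.trans h4⟩
      inter_sets := fun ⟨W, h1, h2, h3⟩ ⟨W', h1', h2', h3'⟩ =>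
        ⟨W ∩ W', inter_mem h1 h1', h2.inter h2', fun y hy =>
          ⟨h3 ⟨hy.1.1, hy.2⟩, h3' ⟨hy.1.2, hy.2⟩⟩⟩ }
  have hm : m.NeBot := by
    refine ⟨fun hbot => ?_⟩
    obtain ⟨W, h1, h2, h3⟩ : ∅ ∈ m := hbot ▸ mem_bot
    obtain ⟨y, hyW, hyc⟩ := l.neBot.nonempty_of_mem (inter_mem h1 hcl)
    obtain ⟨a, ha⟩ := mem_closure_iff.1 hyc W h2 hyW
    exact h3 ha
  obtain ⟨y, hy⟩ := h (Ultrafilter.of m)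
    (Ultrafilter.of_le m ⟨univ, univ_mem, isOpen_univ, inter_subset_right⟩)
  have hly : (l : Filter Y) ≤ 𝓝 y := by
    refine (closed_nhds_basis y).ge_iff.2 fun N hN => ?_
    by_contra hNl
    have h1 : Nᶜ ∈ l := Ultrafilter.compl_mem_iff_notMem.2 hNl
    have h2 : Nᶜ ∈ Ultrafilter.of m :=
      Ultrafilter.of_le m ⟨Nᶜ, h1, hN.2.isOpen_compl, inter_subset_left⟩
    exact Ultrafilter.compl_mem_iff_notMem.1 h2 (hy hN.1)
  exact ⟨y, isClosed_closure.mem_of_tendsto (f := id) hly hcl, hly⟩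

/-! ### Analytic subsets and rescaled maps -/

namespace ComplexSpace

variable {X : Type*} [TopologicalSpace X] [ComplexSpace X]

theorem HolomorphicFunctionAt.continuousAt {h : X → ℂ} {x : X} (hh : HolomorphicFunctionAt h x) :
    ContinuousAt h x := by
  obtain ⟨c, hc, hx⟩ := exists_chart x
  obtain ⟨H, hH, he⟩ := hh c hc hx
  have : ContinuousAt (fun y => H (c.toFun y)) x :=
    ContinuousAt.comp (f := c.toFun) hH.continuousAt (c.continuousAt_toFun hx)
  exact this.congr (he.mono fun y hy => hy.symm)

theorem IsAnalyticSubset.isClosed {S : Set X} (hS : IsAnalyticSubset S) : IsClosed S := by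
  refine isClosed_of_closure_subset fun x hx => ?_
  obtain ⟨k, h, hh, he⟩ := hS x
  refine he.self_of_nhds.2 fun i => ?_
  have hfr : ∃ᶠ y in 𝓝 x, h i y ∈ ({0} : Set ℂ) :=
    ((mem_closure_iff_frequently.1 hx).and_eventually he).mono fun y hy => (hy.2.1 hy.1) i
  exact isClosed_singleton.mem_of_frequently_of_tendsto hfr (hh i).continuousAt

section Extension

variable {Ω : Set ℂ} {M : Set X}

/-- A map `ℂ → X` that extends `f ∈ Hol(Ω, M)`; its values outside `Ω` are irrelevant. -/
noncomputable def holExtend (f : Hol Ω M) : ℂ → X := f.2.choose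

theorem holExtend_apply (f : Hol Ω M) (z : Ω) : holExtend f z = (f : C(Ω, M)) z :=
  f.2.choose_spec.1 z

theorem holomorphicAt_holExtend (f : Hol Ω M) {z : ℂ} (hz : z ∈ Ω) : HolomorphicAt (holExtend f) z :=
  f.2.choose_spec.2 z hz

theorem coe_rescale (f : Hol Ω M) {p : ℂ} {ρ : ℝ} {ξ : ℂ} (h : p + ρ * ξ ∈ Ω) :
    (rescale (f : C(Ω, M)) p ρ ⟨ξ, h⟩ : X) = holExtend f (p + ρ * ξ) :=
  (holExtend_apply f ⟨_, h⟩).symm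

end Extension

theorem tendsto_rescaled_point {ι : Type*} {l : Filter ι} {p : ι → ℂ} {p₀ : ℂ} {ρ : ι → ℝ}
    (hp : Tendsto p l (𝓝 p₀)) (hρ : Tendsto ρ l (𝓝 0)) (ξ : ℂ) :
    Tendsto (fun q : ι × ℂ => p q.1 + ρ q.1 * q.2) (l ×ˢ 𝓝 ξ) (𝓝 p₀) := by
  have h1 : Tendsto (fun q : ι × ℂ => ((ρ q.1 : ℝ) : ℂ)) (l ×ˢ 𝓝 ξ) (𝓝 ((0 : ℝ) : ℂ)) :=
    (Complex.continuous_ofReal.tendsto 0).comp (hρ.comp tendsto_fst)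
  simpa using (hp.comp tendsto_fst).add (h1.mul (tendsto_snd (f := l) (g := 𝓝 ξ)))

theorem tendsto_rescaled_point_const {ι : Type*} {l : Filter ι} {p : ι → ℂ} {p₀ : ℂ} {ρ : ι → ℝ}
    (hp : Tendsto p l (𝓝 p₀)) (hρ : Tendsto ρ l (𝓝 0)) (ξ : ℂ) :
    Tendsto (fun i => p i + ρ i * ξ) l (𝓝 p₀) :=
  (tendsto_rescaled_point hp hρ ξ).comp (tendsto_id.prodMk tendsto_const_nhds)

theorem eventually_rescaled_mem {Ω : Set ℂ} (hΩ : IsOpen Ω) {p : ℕ → ℂ} {p₀ : ℂ} {ρ : ℕ → ℝ}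
    (hp₀ : p₀ ∈ Ω) (hp : Tendsto p atTop (𝓝 p₀)) (hρ : Tendsto ρ atTop (𝓝 0)) {K : Set ℂ}
    (hK : IsCompact K) : ∀ᶠ j in atTop, ∀ ξ ∈ K, p j + ρ j * ξ ∈ Ω :=
  eventually_forall_of_eventually_prod hK fun ξ _ =>
    (tendsto_rescaled_point hp hρ ξ).eventually (hΩ.mem_nhds hp₀)

variable [CompactSpace X] [T2Space X]

/-! ### Sequences extracted from limits along filters -/

/-- A locally uniform limit whose value at a point lies in `S` gives a compactly divergent sequence
after one more rescaling about that point: the images of large discs shrink to a point of `S`. -/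
theorem exists_compactlyDivergent {S : Set X} {Ω : Set ℂ} (hΩ : IsOpen Ω)
    {F : Set (Hol Ω Sᶜ)} {ι : Type*} {l : Filter ι} [l.NeBot] {f : ι → Hol Ω Sᶜ}
    (hf : ∀ᶠ i in l, f i ∈ F) {q : ι → ℂ} {p₀ : ℂ} (hp₀ : p₀ ∈ Ω) (hq : Tendsto q l (𝓝 p₀))
    {ρ : ι → ℝ} (hρ : ∀ᶠ i in l, 0 < ρ i ∧ ρ i ≤ 1) {x : X} (hx : x ∈ S)
    (h : Tendsto (fun p : ι × ℂ => holExtend (f p.1) (q p.1 + ρ p.1 * p.2)) (l ×ˢ 𝓝 0) (𝓝 x)) :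
    ∃ (p : ℕ → ℂ) (f : ℕ → Hol Ω Sᶜ) (ρ : ℕ → ℝ), (∀ j, p j ∈ Ω) ∧ Tendsto p atTop (𝓝 p₀) ∧
      (∀ j, f j ∈ F) ∧ (∀ j, 0 < ρ j) ∧ Tendsto ρ atTop (𝓝 0) ∧
      CompactlyDivergent (fun j => rescale (f j : C(Ω, (Sᶜ : Set X))) (p j) (ρ j)) := by
  have := metrizableSpace (X := X)
  obtain ⟨B, hB⟩ := (𝓝 x).exists_antitone_basis
  have key : ∀ n : ℕ, ∃ i, ∃ δ : ℝ, 0 < δ ∧ δ ≤ 1 ∧ f i ∈ F ∧ q i ∈ Ω ∧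
      dist (q i) p₀ < 1 / ((n : ℝ) + 1) ∧ 0 < ρ i ∧ ρ i ≤ 1 ∧
      ∀ w : ℂ, ‖w‖ < δ → holExtend (f i) (q i + ρ i * w) ∈ B n := by
    intro n
    obtain ⟨pa, hpa, pb, hpb, hab⟩ :=
      eventually_prod_iff.1 (h.eventually (hB.1.mem_of_mem (i := n) trivial))
    obtain ⟨δ, hδ, hδb⟩ := Metric.eventually_nhds_iff_ball.1 hpb
    obtain ⟨i, h1, h2, h3, h4, h5⟩ := (hpa.and (hf.and ((hq.eventually (hΩ.mem_nhds hp₀)).and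
      ((hq.eventually (Metric.ball_mem_nhds p₀ (ε := 1 / ((n : ℝ) + 1)) (by positivity))).and
        hρ)))).exists
    refine ⟨i, min δ 1, by positivity, min_le_right _ _, h2, h3, h4, h5.1, h5.2, fun w hw => ?_⟩
    exact hab h1 (hδb w (by simpa using hw.trans_le (min_le_left _ _)))
  -- shrinking the scale by `δ n / (n + 1)` maps the disc of radius `n` into that of radius `δ n`
  choose i δ hδ hδ1 hiF hiΩ hid hρ0 hρ1 hiB using key
  have hp : Tendsto (fun n => q (i n)) atTop (𝓝 p₀) := by
    rw [tendsto_iff_dist_tendsto_zero]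
    exact squeeze_zero (fun _ => dist_nonneg) (fun n => (hid n).le)
      tendsto_one_div_add_atTop_nhds_zero_nat
  have hr : Tendsto (fun n : ℕ => ρ (i n) * (δ n / ((n : ℝ) + 1))) atTop (𝓝 0) := by
    refine squeeze_zero (fun n => ?_) (fun n => ?_) tendsto_one_div_add_atTop_nhds_zero_nat
    · have := hρ0 n
      have := hδ n
      positivity
    · calc ρ (i n) * (δ n / ((n : ℝ) + 1)) ≤ 1 * (1 / ((n : ℝ) + 1)) := by
            have := hρ1 n
            have := hδ1 n
            have := (hδ n).le
            gcongr
        _ = _ := one_mul _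
  refine ⟨fun n => q (i n), fun n => f (i n), fun n => ρ (i n) * (δ n / ((n : ℝ) + 1)), hiΩ, hp,
    hiF, fun n => ?_, hr, ?_⟩
  · have := hρ0 n
    have := hδ n
    positivity
  intro K hK L hL
  have hLc : IsClosed (Subtype.val '' L) := (hL.image continuous_subtype_val).isClosed
  have hxL : x ∉ Subtype.val '' L := by
    rintro ⟨y, -, rfl⟩
    exact y.2 hx
  obtain ⟨R, hR⟩ := hK.isBounded.exists_norm_le
  obtain ⟨N, hN⟩ := exists_nat_gt R
  have hBL : ∀ᶠ n in atTop, B n ⊆ (Subtype.val '' L)ᶜ :=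
    hB.eventually_subset (hLc.isOpen_compl.mem_nhds hxL)
  obtain ⟨j₀, hj₀⟩ := eventually_atTop.1
    ((eventually_rescaled_mem hΩ hp₀ hp hr hK).and (hBL.and (eventually_ge_atTop N)))
  refine ⟨j₀, fun j hj ξ hξ => ?_⟩
  obtain ⟨h1, h2, h3⟩ := hj₀ j hj
  refine ⟨h1 ξ hξ, fun hmem => ?_⟩
  refine h2 ?_ (mem_image_of_mem _ hmem)
  rw [coe_rescale]
  have heq : ((ρ (i j) * (δ j / ((j : ℝ) + 1)) : ℝ) : ℂ) * ξ =
      ρ (i j) * (((δ j / ((j : ℝ) + 1) : ℝ) : ℂ) * ξ) := by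
    push_cast
    ring
  rw [heq]
  refine hiB j _ ?_
  have hd := hδ j
  rw [norm_mul, Complex.norm_real, Real.norm_of_nonneg (by positivity), div_mul_eq_mul_div,
    div_lt_iff₀ (by positivity)]
  have : ‖ξ‖ < (j : ℝ) + 1 := by
    have : (N : ℝ) ≤ j := by exact_mod_cast h3
    linarith [hR ξ hξ]
  gcongr

/-- A limit of rescaled maps along a filter is also the limit of a sequence of rescaled maps. -/
theorem exists_convergesUniformlyOnCompacts {S : Set X} {Ω : Set ℂ} (hΩ : IsOpen Ω)
    {F : Set (Hol Ω Sᶜ)} {ι : Type*} {l : Filter ι} [l.NeBot] {f : ι → Hol Ω Sᶜ}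
    (hf : ∀ᶠ i in l, f i ∈ F) {q : ι → ℂ} {p₀ : ℂ} (hp₀ : p₀ ∈ Ω) (hq : Tendsto q l (𝓝 p₀))
    {ρ : ι → ℝ} (hρ : ∀ᶠ i in l, 0 < ρ i) (hρ0 : Tendsto ρ l (𝓝 0)) {g : ℂ → (Sᶜ : Set X)}
    (h : ∀ z, Tendsto (fun p : ι × ℂ => holExtend (f p.1) (q p.1 + ρ p.1 * p.2)) (l ×ˢ 𝓝 z)
      (𝓝 (g z : X))) :
    ∃ (p : ℕ → ℂ) (f : ℕ → Hol Ω Sᶜ) (ρ : ℕ → ℝ), (∀ j, p j ∈ Ω) ∧ Tendsto p atTop (𝓝 p₀) ∧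
      (∀ j, f j ∈ F) ∧ (∀ j, 0 < ρ j) ∧ Tendsto ρ atTop (𝓝 0) ∧
      ConvergesUniformlyOnCompacts
        (fun j => rescale (f j : C(Ω, (Sᶜ : Set X))) (p j) (ρ j)) g := by
  have hV : ∃ V : ℕ → Set (X × X),
      (uniformSpaceOfCompactR1 (γ := X)).uniformity.HasAntitoneBasis V := by
    have := metrizableSpace (X := X)
    let := TopologicalSpace.metrizableSpaceMetric X
    have h1 : (uniformSpaceOfCompactR1 (γ := X)).uniformity = uniformity X :=
      nhdsSet_diagonal_eq_uniformity
    rw [h1]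
    exact (uniformity X).exists_antitone_basis
  obtain ⟨V, hV⟩ := hV
  have key : ∀ n : ℕ, ∃ i, f i ∈ F ∧ q i ∈ Ω ∧ dist (q i) p₀ < 1 / ((n : ℝ) + 1) ∧ 0 < ρ i ∧
      ρ i < 1 / ((n : ℝ) + 1) ∧ ∀ ξ ∈ Metric.closedBall (0 : ℂ) n,
        ((g ξ : X), holExtend (f i) (q i + ρ i * ξ)) ∈ V n := by
    intro n
    have h1 : ∀ᶠ i in l, ∀ ξ ∈ Metric.closedBall (0 : ℂ) n,
        ((g ξ : X), holExtend (f i) (q i + ρ i * ξ)) ∈ V n := by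
      refine eventually_forall_of_eventually_prod (isCompact_closedBall _ _) fun z _ => ?_
      have hgc : ContinuousAt (fun z => (g z : X)) z :=
        continuousAt_of_tendsto_prod (G := fun i w => holExtend (f i) (q i + ρ i * w)) isOpen_univ
          (fun z _ => h z) (mem_univ z)
      have h2 := (hgc.tendsto.comp (tendsto_snd (f := l) (g := 𝓝 z))).prodMk_nhds (h z)
      have h3 : V n ∈ 𝓝 ((g z : X), (g z : X)) := by
        let := uniformSpaceOfCompactR1 (γ := X)
        exact nhds_le_uniformity (g z : X) (hV.1.mem_of_mem trivial)
      exact h2.eventually h3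
    have hn : (0 : ℝ) < 1 / ((n : ℝ) + 1) := by positivity
    obtain ⟨i, h2, h3, h4, h5, h6, h7⟩ := (hf.and ((hq.eventually (hΩ.mem_nhds hp₀)).and
      ((hq.eventually (Metric.ball_mem_nhds p₀ hn)).and (hρ.and
        ((hρ0.eventually_lt_const hn).and h1))))).exists
    exact ⟨i, h2, h3, h4, h5, h6, h7⟩
  choose i hiF hiΩ hid hρ0 hρ1 hiV using key
  have hp : Tendsto (fun n => q (i n)) atTop (𝓝 p₀) := by
    rw [tendsto_iff_dist_tendsto_zero]
    exact squeeze_zero (fun _ => dist_nonneg) (fun n => (hid n).le)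
      tendsto_one_div_add_atTop_nhds_zero_nat
  have hr : Tendsto (fun n => ρ (i n)) atTop (𝓝 0) :=
    squeeze_zero (fun n => (hρ0 n).le) (fun n => (hρ1 n).le)
      tendsto_one_div_add_atTop_nhds_zero_nat
  refine ⟨fun n => q (i n), fun n => f (i n), fun n => ρ (i n), hiΩ, hp, hiF, hρ0, hr, ?_⟩
  intro K hK W hW
  obtain ⟨R, hR⟩ := hK.isBounded.exists_norm_le
  obtain ⟨N, hN⟩ := exists_nat_gt R
  obtain ⟨j₀, hj₀⟩ := eventually_atTop.1
    ((eventually_rescaled_mem hΩ hp₀ hp hr hK).and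
      ((hV.eventually_subset hW).and (eventually_ge_atTop N)))
  refine ⟨j₀, fun j hj ξ hξ => ?_⟩
  obtain ⟨h1, h2, h3⟩ := hj₀ j hj
  refine ⟨h1 ξ hξ, h2 ?_⟩
  rw [coe_rescale]
  refine hiV j ξ ?_
  rw [mem_closedBall_zero_iff]
  have : (N : ℝ) ≤ j := by exact_mod_cast h3
  linarith [hR ξ hξ]

end ComplexSpace

/-! ### Normal families -/

namespace ComplexSpace

variable {X : Type*} [TopologicalSpace X] [ComplexSpace X]

/-- A normal family admits none of the two kinds of rescaled sequences: along an ultrafilter the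
maps converge uniformly near `p₀`, so that the rescaled maps converge to a constant in `M`. -/
theorem IsNormalFamily.not_exists_sequences [CompactSpace X] [T2Space X] {M : Set X}
    (hM : IsOpen M) {Ω : Set ℂ} (hΩ : IsOpen Ω) {F : Set (Hol Ω M)} (hF : IsNormalFamily F)
    {p : ℕ → ℂ} {p₀ : ℂ} {f : ℕ → Hol Ω M} {ρ : ℕ → ℝ} (hp₀ : p₀ ∈ Ω)
    (hp : Tendsto p atTop (𝓝 p₀)) (hf : ∀ j, f j ∈ F) (hρ : Tendsto ρ atTop (𝓝 0)) :
    ¬ CompactlyDivergent (fun j => rescale (f j : C(Ω, M)) (p j) (ρ j)) ∧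
      ∀ g : ℂ → M, ConvergesUniformlyOnCompacts
        (fun j => rescale (f j : C(Ω, M)) (p j) (ρ j)) g → ∃ a, ∀ ξ, g ξ = a := by
  have : LocallyCompactSpace M := hM.locallyCompactSpace
  have : LocallyCompactSpace Ω := hΩ.locallyCompactSpace
  let l : Ultrafilter ℕ := hyperfilter ℕ
  have hl : (l : Filter ℕ) ≤ atTop := Nat.hyperfilter_le_atTop
  obtain ⟨f₀, -, hf₀⟩ := IsCompact.ultrafilter_le_nhds hF (l.map f)
    (le_principal_iff.2 (mem_map.2 (Eventually.of_forall fun j => subset_closure (hf j))))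
  have hf₀' : Tendsto (fun j => (f j : C(Ω, M))) l (𝓝 (f₀ : C(Ω, M))) :=
    (continuous_subtype_val.tendsto f₀).comp hf₀
  have key : ∀ ξ, Tendsto (fun j => holExtend (f j) (p j + ρ j * ξ)) l
      (𝓝 ((f₀ : C(Ω, M)) ⟨p₀, hp₀⟩ : X)) := by
    intro ξ
    classical
    let w : ℕ → Ω := fun j => if h : p j + ρ j * ξ ∈ Ω then ⟨_, h⟩ else ⟨p₀, hp₀⟩
    have hev : ∀ᶠ j in l, p j + ρ j * ξ ∈ Ω :=
      ((tendsto_rescaled_point_const hp hρ ξ).mono_left hl).eventually (hΩ.mem_nhds hp₀)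
    have hw : Tendsto w l (𝓝 ⟨p₀, hp₀⟩) := by
      refine tendsto_subtype_rng.2
        (((tendsto_rescaled_point_const hp hρ ξ).mono_left hl).congr' (hev.mono fun j hj => ?_))
      simp [w, hj]
    have h1 : Tendsto (fun j => (f j : C(Ω, M)) (w j)) l (𝓝 ((f₀ : C(Ω, M)) ⟨p₀, hp₀⟩)) :=
      hf₀'.eval hw
    refine ((continuous_subtype_val.tendsto _).comp h1).congr' (hev.mono fun j hj => ?_)
    simp only [Function.comp, w, dif_pos hj]
    exact (holExtend_apply (f j) ⟨_, hj⟩).symm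
  constructor
  · intro hdiv
    obtain ⟨L, hL, hLn⟩ := exists_compact_mem_nhds ((f₀ : C(Ω, M)) ⟨p₀, hp₀⟩)
    obtain ⟨j₀, hj₀⟩ := hdiv {0} isCompact_singleton L hL
    have h1 : Subtype.val '' L ∈ 𝓝 ((f₀ : C(Ω, M)) ⟨p₀, hp₀⟩ : X) :=
      hM.isOpenMap_subtype_val.image_mem_nhds hLn
    obtain ⟨j, hj, y, hy, hye⟩ := (((eventually_ge_atTop j₀).filter_mono hl).and
      ((key 0).eventually h1)).exists
    obtain ⟨h2, h3⟩ := hj₀ j hj 0 rfl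
    refine h3 ?_
    have : (rescale (f j : C(Ω, M)) (p j) (ρ j) ⟨0, h2⟩) = y :=
      Subtype.ext ((coe_rescale (f j) h2).trans hye.symm)
    simpa only [this] using hy
  · intro g hg
    refine ⟨(f₀ : C(Ω, M)) ⟨p₀, hp₀⟩, fun ξ => Subtype.ext ?_⟩
    refine tendsto_nhds_unique (Tendsto.mono_left ?_ hl) (key ξ)
    let := uniformSpaceOfCompactR1 (γ := X)
    rw [Uniform.tendsto_nhds_right, tendsto_def]
    intro V hV
    obtain ⟨j₀, hj₀⟩ := hg {ξ} isCompact_singleton V hV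
    filter_upwards [eventually_ge_atTop j₀] with j hj
    obtain ⟨h1, h2⟩ := hj₀ j hj ξ rfl
    rw [coe_rescale] at h2
    exact h2

/-- If the speeds of the members of `F` are locally bounded and no limit of members of `F` meets
`S`, then `F` is normal; if some limit meets `S`, then rescaling there gives a compactly divergent
sequence. -/
theorem isNormalFamily_or_exists_compactlyDivergent [CompactSpace X] [T2Space X]
    (E : LengthFunction X) {S : Set X} {Ω : Set ℂ} (hΩ : IsOpen Ω) {F : Set (Hol Ω Sᶜ)}
    (hb : ∀ z ∈ Ω, ∃ C, ∀ᶠ w in 𝓝 z, ∀ f ∈ F, E.speed (holExtend f) w ≤ C) :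
    IsNormalFamily F ∨ ∃ p₀ ∈ Ω, ∃ (p : ℕ → ℂ) (f : ℕ → Hol Ω Sᶜ) (ρ : ℕ → ℝ),
      (∀ j, p j ∈ Ω) ∧ Tendsto p atTop (𝓝 p₀) ∧
      (∀ j, f j ∈ F) ∧ (∀ j, 0 < ρ j) ∧ Tendsto ρ atTop (𝓝 0) ∧
      CompactlyDivergent (fun j => rescale (f j : C(Ω, (Sᶜ : Set X))) (p j) (ρ j)) := by
  refine or_iff_not_imp_right.2 fun hno => isCompact_closure_of_ultrafilter fun l hl => ?_
  have hhol : ∀ z ∈ Ω, ∀ᶠ p in (l : Filter (Hol Ω Sᶜ)) ×ˢ 𝓝 z,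
      HolomorphicAt (holExtend p.1) p.2 := fun z hz =>
    (tendsto_snd.eventually (hΩ.mem_nhds hz)).mono fun p hp => holomorphicAt_holExtend p.1 hp
  obtain ⟨g, hg⟩ := E.exists_tendsto_prod l (G := holExtend) (U := Ω) fun z hz => by
    obtain ⟨C, hC⟩ := hb z hz
    refine ⟨C, (hhol z hz).and ?_⟩
    filter_upwards [prod_mem_prod hl hC] with p hp
    exact hp.2 p.1 hp.1
  have hgh : ∀ z ∈ Ω, HolomorphicAt g z := fun z hz =>
    (E.holomorphicAt_of_tendsto_prod hΩ hhol hg hz).1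
  have hgS : ∀ z ∈ Ω, g z ∈ Sᶜ := by
    intro p₀ hp₀ hS
    refine hno ⟨p₀, hp₀, ?_⟩
    refine exists_compactlyDivergent hΩ (l := (l : Filter (Hol Ω Sᶜ))) (f := id) hl
      (q := fun _ => p₀) hp₀ tendsto_const_nhds (ρ := fun _ => 1)
      (Eventually.of_forall fun _ => ⟨one_pos, le_rfl⟩) hS ?_
    have h1 : Tendsto (fun w : ℂ => p₀ + ((1 : ℝ) : ℂ) * w) (𝓝 0) (𝓝 p₀) :=
      Continuous.tendsto' (by fun_prop) _ _ (by simp)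
    exact (hg p₀ hp₀).comp (tendsto_id.prodMap h1)
  let g' : C(Ω, (Sᶜ : Set X)) :=
    ⟨fun z => ⟨g z, hgS z z.2⟩, Continuous.subtype_mk (continuous_iff_continuousAt.2 fun z =>
      ContinuousAt.comp (f := Subtype.val) (hgh z z.2).1 continuousAt_subtype_val) _⟩
  refine ⟨⟨g', g, fun z => rfl, hgh⟩, ?_⟩
  have hT : Tendsto (fun f : Hol Ω Sᶜ => (f : C(Ω, (Sᶜ : Set X)))) l (𝓝 g') := by
    rw [ContinuousMap.tendsto_nhds_compactOpen]
    intro K hK U hU hKU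
    obtain ⟨U', hU', rfl⟩ := hU
    refine eventually_forall_of_eventually_prod hK fun z hz => ?_
    have h1 : Tendsto (fun p : Hol Ω Sᶜ × Ω => holExtend p.1 p.2) ((l : Filter (Hol Ω Sᶜ)) ×ˢ 𝓝 z)
        (𝓝 (g z)) :=
      (hg z z.2).comp (tendsto_id.prodMap (continuous_subtype_val.tendsto z))
    filter_upwards [h1.eventually (hU'.mem_nhds (show g z ∈ U' from hKU hz))] with p hp
    rw [holExtend_apply] at hp
    exact hp
  exact tendsto_subtype_rng.2 hT

/-- The rescaling theorem of Brody and Zalcman: if the speeds of the members of `F` are unbounded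
near a point, then some rescaled maps converge along an ultrafilter to a non-constant curve `g` in
`X` of bounded speed. -/
theorem exists_rescaled_limit [CompactSpace X] [T2Space X] (E : LengthFunction X) {M : Set X}
    {Ω : Set ℂ} (hΩ : IsOpen Ω) {F : Set (Hol Ω M)} {z₀ : ℂ} (hz₀ : z₀ ∈ Ω)
    (hub : ∀ C, ∃ᶠ w in 𝓝 z₀, ∃ f ∈ F, C < E.speed (holExtend f) w) :
    ∃ (l : Ultrafilter ℕ) (p : ℕ → ℂ) (f : ℕ → Hol Ω M) (ρ : ℕ → ℝ) (g : ℂ → X),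
      ∃ p₀ ∈ Ω, Tendsto p l (𝓝 p₀) ∧ (∀ j, f j ∈ F) ∧ (∀ j, 0 < ρ j) ∧ Tendsto ρ l (𝓝 0) ∧
      (∀ z, Tendsto (fun q : ℕ × ℂ => holExtend (f q.1) (p q.1 + ρ q.1 * q.2))
        ((l : Filter ℕ) ×ˢ 𝓝 z) (𝓝 (g z))) ∧
      IsBrodyCurve E g ∧ ¬ ∃ a, ∀ ξ, g ξ = a := by
  obtain ⟨r, hr, hrΩ⟩ := Metric.nhds_basis_closedBall.mem_iff.1 (hΩ.mem_nhds hz₀)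
  -- a point `w` with `dist w z₀ < r / 2` and speed above `2 (j + 1) / r` makes the product
  -- `(r - dist w z₀) * speed` exceed `j + 1`
  have key : ∀ j : ℕ, ∃ f ∈ F, ∃ p ∈ Metric.closedBall z₀ r, ∃ ρ > 0, ρ ≤ r / ((j : ℝ) + 1) ∧
      ρ * E.speed (holExtend f) p = 1 ∧ ∀ ξ : ℂ, ‖ξ‖ ≤ ((j : ℝ) + 1) / 2 →
        p + (ρ : ℝ) * ξ ∈ Metric.closedBall z₀ r ∧
          ρ * E.speed (holExtend f) (p + (ρ : ℝ) * ξ) ≤ 2 := by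
    intro j
    obtain ⟨w, ⟨f, hf, hw⟩, hwb⟩ := ((hub (2 * ((j : ℝ) + 1) / r)).and_eventually
      (Metric.ball_mem_nhds z₀ (half_pos hr))).exists
    replace hwb : dist w z₀ < r / 2 := hwb
    refine ⟨f, hf, exists_rescaling (z := w) (by positivity) (E.speed_nonneg _)
      (E.continuousOn_speed fun z hz => holomorphicAt_holExtend f (hrΩ hz))
      (by rw [Metric.mem_closedBall]; linarith) ?_⟩
    have h1 : (j : ℝ) + 1 = r / 2 * (2 * ((j : ℝ) + 1) / r) := by field_simp
    rw [h1]
    exact mul_le_mul (by linarith) hw.le (by positivity) (by linarith)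
  choose f hf p hp ρ hρ hρr h1 h2 using key
  let l : Ultrafilter ℕ := hyperfilter ℕ
  have hl : (l : Filter ℕ) ≤ atTop := Nat.hyperfilter_le_atTop
  obtain ⟨p₀, hp₀, hpl⟩ := (isCompact_closedBall z₀ r).ultrafilter_le_nhds (l.map p)
    (le_principal_iff.2 (mem_map.2 (Eventually.of_forall hp)))
  have hρ0 : Tendsto ρ atTop (𝓝 0) := by
    refine squeeze_zero (fun j => (hρ j).le) hρr ?_
    simpa [div_eq_mul_inv] using (tendsto_one_div_add_atTop_nhds_zero_nat (𝕜 := ℝ)).const_mul r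
  set G : ℕ → ℂ → X := fun j ξ => holExtend (f j) (p j + ρ j * ξ)
  have hG : ∀ (j : ℕ) (ξ : ℂ), ‖ξ‖ ≤ ((j : ℝ) + 1) / 2 →
      HolomorphicAt (G j) ξ ∧ E.speed (G j) ξ ≤ 2 := by
    intro j ξ hξ
    obtain ⟨h3, h4⟩ := h2 j ξ hξ
    have h5 := holomorphicAt_holExtend (f j) (hrΩ h3)
    exact ⟨h5.comp_affine, (E.speed_comp_affine (hρ j).le h5).trans_le h4⟩
  have hGev : ∀ z : ℂ, ∀ᶠ q in (l : Filter ℕ) ×ˢ 𝓝 z,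
      HolomorphicAt (G q.1) q.2 ∧ E.speed (G q.1) q.2 ≤ 2 := by
    intro z
    obtain ⟨N, hN⟩ := exists_nat_gt (2 * (‖z‖ + 1))
    filter_upwards [prod_mem_prod (hl (eventually_ge_atTop N)) (Metric.ball_mem_nhds z one_pos)]
      with q hq
    refine hG _ _ ?_
    have h3 : (N : ℝ) ≤ q.1 := by exact_mod_cast hq.1
    have h4 : ‖q.2 - z‖ < 1 := by simpa [dist_eq_norm] using hq.2
    have h5 := norm_le_norm_add_norm_sub' q.2 z
    linarith
  obtain ⟨g, hg⟩ := E.exists_tendsto_prod l (G := G) (U := univ) fun z _ => ⟨2, hGev z⟩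
  have hgl := fun z => E.holomorphicAt_of_tendsto_prod isOpen_univ
    (fun z _ => (hGev z).mono fun q hq => hq.1) hg (mem_univ z)
  have hg2 : ∀ z, E.speed g z ≤ 2 := fun z =>
    le_of_tendsto (hgl z).2 ((hGev z).curry.mono fun j hj => hj.self_of_nhds.2)
  have hg1 : E.speed g 0 = 1 := by
    refine tendsto_nhds_unique (hgl 0).2 (tendsto_const_nhds.congr fun j => ?_)
    have h3 : HolomorphicAt (holExtend (f j)) (p j + ρ j * 0) := by
      simpa using holomorphicAt_holExtend (f j) (hrΩ (hp j))
    rw [E.speed_comp_affine (hρ j).le h3, mul_zero, add_zero, h1]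
  refine ⟨l, p, f, ρ, g, p₀, hrΩ hp₀, hpl, hf, hρ, hρ0.mono_left hl, fun z => hg z (mem_univ z),
    ⟨fun z => (hgl z).1, 2, fun z => ?_⟩, ?_⟩
  · rw [← E.speed_eq_velocity]
    exact hg2 z
  · rintro ⟨a, ha⟩
    have := E.speed_const (hgl 0).1 fun w => (ha w).trans (ha 0).symm
    linarith

end ComplexSpace

theorem theorem1p6 {X : Type*} [TopologicalSpace X] [CompactSpace X] [T2Space X] [ComplexSpace X]
    (E : ComplexSpace.LengthFunction X) (S : Set X) (hS : ComplexSpace.IsHypersurface S)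
    (Ω : Set ℂ) (hΩ : IsOpen Ω) (hΩ' : IsConnected Ω)
    (F : Set (ComplexSpace.Hol Ω Sᶜ)) :
    ¬ ComplexSpace.IsNormalFamily F ↔
      ∃ (p : ℕ → ℂ) (p₀ : ℂ) (f : ℕ → ComplexSpace.Hol Ω Sᶜ) (ρ : ℕ → ℝ),
        (∀ j, p j ∈ Ω) ∧ p₀ ∈ Ω ∧ Tendsto p atTop (𝓝 p₀) ∧
        (∀ j, f j ∈ F) ∧
        (∀ j, 0 < ρ j) ∧ Tendsto ρ atTop (𝓝 0) ∧
        (ComplexSpace.CompactlyDivergent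
            (fun j => ComplexSpace.rescale (f j : C(Ω, (Sᶜ : Set X))) (p j) (ρ j)) ∨
          ∃ g : ℂ → (Sᶜ : Set X),
            ComplexSpace.IsBrodyCurve E (fun ξ => (g ξ : X)) ∧
            (¬ ∃ a, ∀ ξ, g ξ = a) ∧
            ComplexSpace.ConvergesUniformlyOnCompacts
              (fun j => ComplexSpace.rescale (f j : C(Ω, (Sᶜ : Set X))) (p j) (ρ j)) g) := by
  constructor
  · intro hF
    by_cases hb : ∀ z ∈ Ω, ∃ C, ∀ᶠ w in 𝓝 z, ∀ f ∈ F, E.speed (ComplexSpace.holExtend f) w ≤ C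
    · obtain ⟨p₀, hp₀, p, f, ρ, h1, h2, h3, h4, h5, h6⟩ :=
        (ComplexSpace.isNormalFamily_or_exists_compactlyDivergent E hΩ hb).resolve_left hF
      exact ⟨p, p₀, f, ρ, h1, hp₀, h2, h3, h4, h5, Or.inl h6⟩
    push Not at hb
    obtain ⟨z₀, hz₀, hub⟩ := hb
    obtain ⟨l, q, φ, r, g, p₀, hp₀, hq, hφ, hr, hr0, hg, hgB, hgc⟩ :=
      ComplexSpace.exists_rescaled_limit E hΩ hz₀ hub
    by_cases hgS : ∃ ξ₀, g ξ₀ ∈ S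
    · -- rescale once more about a point where the limit curve meets `S`
      obtain ⟨ξ₀, hξ₀⟩ := hgS
      have hT : Tendsto (fun x : ℕ × ℂ =>
          ComplexSpace.holExtend (φ x.1) (q x.1 + r x.1 * ξ₀ + r x.1 * x.2))
          ((l : Filter ℕ) ×ˢ 𝓝 0) (𝓝 (g ξ₀)) := by
        have h1 : Tendsto (fun w : ℂ => ξ₀ + w) (𝓝 0) (𝓝 ξ₀) :=
          Continuous.tendsto' (by fun_prop) _ _ (by simp)
        refine ((hg ξ₀).comp (tendsto_id.prodMap h1)).congr fun x => ?_
        simp only [Function.comp, Prod.map, id, mul_add, add_assoc]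
      obtain ⟨p, f, ρ, h1, h2, h3, h4, h5, h6⟩ := ComplexSpace.exists_compactlyDivergent hΩ
        (Eventually.of_forall hφ) hp₀ (ComplexSpace.tendsto_rescaled_point_const hq hr0 ξ₀)
        ((hr0.eventually_le_const one_pos).mono fun j hj => ⟨hr j, hj⟩) hξ₀ hT
      exact ⟨p, p₀, f, ρ, h1, hp₀, h2, h3, h4, h5, Or.inl h6⟩
    · push Not at hgS
      obtain ⟨p, f, ρ, h1, h2, h3, h4, h5, h6⟩ := ComplexSpace.exists_convergesUniformlyOnCompacts hΩ
        (Eventually.of_forall hφ) hp₀ hq (Eventually.of_forall hr) hr0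
        (g := fun ξ => ⟨g ξ, hgS ξ⟩) hg
      exact ⟨p, p₀, f, ρ, h1, hp₀, h2, h3, h4, h5, Or.inr ⟨_, hgB,
        fun ⟨a, ha⟩ => hgc ⟨a, fun ξ => congrArg Subtype.val (ha ξ)⟩, h6⟩⟩
  · rintro ⟨p, p₀, f, ρ, -, hp₀, hp, hf, -, hρ, h⟩ hF
    obtain ⟨h1, h2⟩ := hF.not_exists_sequences hS.1.isClosed.isOpen_compl hΩ hp₀ hp hf hρ
    rcases h with h | ⟨g, -, hg, hgc⟩
    exacts [h1 h, hg (h2 g hgc)]
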